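/- Let $K$ be an algebraically closed field of characteristic zero, let $T=(K^\times)^r$ be a torus with Lie algebra $\mathfrak t=K^r$, and let $V$ be a finite-dimensional algebraic representation of $T$. Write $V/\!\!/T=\operatorname{Spec}K[V]^T$, and for $v\in V$ put $\mathfrak c_v=\{x\in V\mid \mathfrak t\cdot x\subseteq \mathfrak t\cdot v\}$. A vector $x\in V$ is nilpotent if $0\in\overline{T.x}$ (Zariski closure). The representation is visible if it has only finitely many nilpotent orbits, and polar if there is $v\in V$ with $\dim\mathfrak c_v=\dim V/\!\!/T$; such a $\mathfrak c_v$ is then called a Cartan subspace. Assume that $(T,V)$ is visible. Then $(T,V)$ is polar. More precisely, $V$ has a basis of weight vectors, and for every basis $b_1,\dots,b_n$ of $V$ consisting of weight vectors, with weights $s_1,\dots,s_n\in X^*(T)=\mathbb Z^r$, the following holds. (a) There are an integer $l\ge 0$ and a partition $\{1,\dots,n\}=\bigsqcup_{j=0}^{l}I_j$ (with $I_0$ possibly empty) such that, taking linear spans in $X^*(T)\otimes_{\mathbb Z}\mathbb Q=\mathbb Q^r$: (i) $\langle s_i\mid 1\le i\le n\rangle=\bigoplus_{j=0}^{l}\langle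 s_i\mid i\in I_j\rangle$; (ii) $\dim\langle s_i\mid i\in I_0\rangle=\#I_0$, and $\dim\langle s_i\mid i\in I_j\rangle=\#I_j-1$ for $1\le j\le l$; (iii) for $1\le j\le l$, $0$ is a convex combination with all coefficients positive of the elements of $\{s_i\mid i\in I_j\}$. (b) For every $l$ and every partition as in (a), and for $w\in K^l$, let $x(w)=\sum_{j=1}^{l}w_j\sum_{i\in I_j}b_i$. Then $\mathfrak c=\{x(w)\mid w\in K^l\}$ is equal to $\mathfrak c_{x(1,\dots,1)}$, it is a Cartan subspace of $V$, and $\dim \mathfrak c=l=\dim V/\!\!/T$. -/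

import Mathlib

namespace TorusRep

noncomputable section

section Torus

variable {K : Type*} [Field K] {r : ℕ} {V : Type*} [AddCommGroup V] [Module K V]

/-- The character `t ↦ ∏ j, t_j ^ (m_j)` of the torus `(Kˣ)^r` attached to `m ∈ ℤ^r`. -/
def character (m : Fin r → ℤ) (t : Fin r → Kˣ) : K :=
  ((∏ j, t j ^ m j : Kˣ) : K)

/-- The differential at the identity of the character attached to `m`: the linear form
`ξ ↦ ∑ j, m_j ξ_j` on the Lie algebra `K^r` of the torus. -/
def characterDiff (K : Type*) [Field K] {r : ℕ} (m : Fin r → ℤ) : (Fin r → K) →ₗ[K] K :=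
  ∑ j, (m j : K) • LinearMap.proj j

/-- The representation is algebraic: `t ↦ ρ t` is a Laurent polynomial in the coordinates of `t`
with coefficients in `End V`, i.e. the matrix entries of `ρ` are regular functions on the torus. -/
def IsAlgebraic (ρ : Representation K (Fin r → Kˣ) V) : Prop :=
  ∃ P : (Fin r → ℤ) →₀ Module.End K V,
    ∀ t : Fin r → Kˣ, ρ t = P.sum fun m A => character m t • A

/-- The differential at the identity of an algebraic representation of the torus `(Kˣ)^r`: if
`ρ t = ∑ m, t^m • P_m`, then `ξ ∈ K^r` acts by `∑ m, (∑ j, m_j ξ_j) • P_m`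
(the `P_m` are uniquely determined by `ρ` when `K` is infinite). -/
def differential (ρ : Representation K (Fin r → Kˣ) V) (hρ : IsAlgebraic ρ) :
    (Fin r → K) →ₗ[K] Module.End K V :=
  hρ.choose.sum fun m A => (characterDiff K m).smulRight A

/-- The subspace `𝔱 · v` of `V`, where `𝔱 = K^r` is the Lie algebra of the torus. -/
def lieOrbit (ρ : Representation K (Fin r → Kˣ) V) (hρ : IsAlgebraic ρ) (v : V) :
    Submodule K V :=
  LinearMap.range ((differential ρ hρ).flip v)

/-- The subspace `𝔠_v = {x ∈ V | 𝔱 · x ⊆ 𝔱 · v}`. -/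
def cartanCandidate (ρ : Representation K (Fin r → Kˣ) V) (hρ : IsAlgebraic ρ) (v : V) :
    Submodule K V where
  carrier := {x | lieOrbit ρ hρ x ≤ lieOrbit ρ hρ v}
  zero_mem' := by
    rintro _ ⟨ξ, rfl⟩
    simp
  add_mem' := by
    rintro x y hx hy _ ⟨ξ, rfl⟩
    rw [map_add, LinearMap.add_apply]
    exact add_mem (hx ⟨ξ, rfl⟩) (hy ⟨ξ, rfl⟩)
  smul_mem' := by
    rintro a x hx _ ⟨ξ, rfl⟩
    rw [map_smul, LinearMap.smul_apply]
    exact Submodule.smul_mem _ a (hx ⟨ξ, rfl⟩)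

variable (K V) in
/-- The algebra `K[V]` of polynomial functions on `V`, generated by the linear forms. -/
def polyFun : Subalgebra K (V → K) :=
  Algebra.adjoin K (Set.range fun φ : Module.Dual K V => (φ : V → K))

variable (K) in
/-- The closure of a subset of `V` for the Zariski topology. -/
def zariskiClosure (S : Set V) : Set V :=
  {x | ∀ f ∈ polyFun K V, (∀ y ∈ S, f y = 0) → f x = 0}

/-- The algebra `K[V]^T` of invariant polynomial functions. -/
def invariants (ρ : Representation K (Fin r → Kˣ) V) : Subalgebra K (V → K) where
  carrier := {f | f ∈ polyFun K V ∧ ∀ t v, f (ρ t v) = f v}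
  mul_mem' := fun hf hg => ⟨mul_mem hf.1 hg.1, fun t v => by simp [hf.2, hg.2]⟩
  add_mem' := fun hf hg => ⟨add_mem hf.1 hg.1, fun t v => by simp [hf.2, hg.2]⟩
  algebraMap_mem' := fun a => ⟨Subalgebra.algebraMap_mem _ a, fun _ _ => rfl⟩

/-- The dimension of the categorical quotient `V // T = Spec K[V]^T`. -/
def quotientDim (ρ : Representation K (Fin r → Kˣ) V) : WithBot ℕ∞ :=
  ringKrullDim (invariants ρ)

/-- The orbit `T . x`. -/
def orbit (ρ : Representation K (Fin r → Kˣ) V) (x : V) : Set V :=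
  Set.range fun t => ρ t x

/-- `x` is nilpotent if `0` lies in the closure of the orbit of `x`. -/
def IsNilpotentVec (ρ : Representation K (Fin r → Kˣ) V) (x : V) : Prop :=
  (0 : V) ∈ zariskiClosure K (orbit ρ x)

/-- There are finitely many nilpotent orbits. -/
def IsVisible (ρ : Representation K (Fin r → Kˣ) V) : Prop :=
  (orbit ρ '' {x | IsNilpotentVec ρ x}).Finite

/-- `c` is a Cartan subspace: it is of the form `𝔠_v`, with `dim 𝔠_v = dim V // T`. -/
def IsCartanSubspace (ρ : Representation K (Fin r → Kˣ) V) (hρ : IsAlgebraic ρ)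
    (c : Submodule K V) : Prop :=
  ∃ v : V, c = cartanCandidate ρ hρ v ∧
    (Module.finrank K (cartanCandidate ρ hρ v) : WithBot ℕ∞) = quotientDim ρ

/-- There is `v` with `dim 𝔠_v = dim V // T`. -/
def IsPolar (ρ : Representation K (Fin r → Kˣ) V) (hρ : IsAlgebraic ρ) : Prop :=
  ∃ v : V, (Module.finrank K (cartanCandidate ρ hρ v) : WithBot ℕ∞) = quotientDim ρ

/-- The basis `b` diagonalizes the representation, `b i` having weight `s i`. -/
def IsWeightBasis (ρ : Representation K (Fin r → Kˣ) V) {n : ℕ} (b : Module.Basis (Fin n) K V)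
    (s : Fin n → Fin r → ℤ) : Prop :=
  ∀ (t : Fin r → Kˣ) (i : Fin n), ρ t (b i) = character (s i) t • b i

/-- The linear map `w ↦ x(w)`, where `x(w) ∈ V` has coordinate `0` at the indices in `I 0`
and coordinate `w j` at the indices in the `j`-th of the blocks `I 1, …, I l`. -/
def blockMap {n l : ℕ} (b : Module.Basis (Fin n) K V) (I : Fin (l + 1) → Finset (Fin n)) :
    (Fin l → K) →ₗ[K] V :=
  Fintype.linearCombination K fun j : Fin l => ∑ i ∈ I j.succ, b i

end Torus

/-- The set of convex combinations of the elements of `A` with all coefficients positive. -/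
def openConvexHull {r : ℕ} (A : Finset (Fin r → ℚ)) : Set (Fin r → ℚ) :=
  {x | ∃ α : (Fin r → ℚ) → ℚ,
    (∀ a ∈ A, 0 < α a) ∧ ∑ a ∈ A, α a = 1 ∧ ∑ a ∈ A, α a • a = x}

/-- A weight, seen in the rational vector space `X^*(T) ⊗ ℚ = ℚ^r`. -/
def ratWeight {r : ℕ} (m : Fin r → ℤ) : Fin r → ℚ := fun j => (m j : ℚ)

/-- The rational span of the weights with indices in `J`. -/
def weightSpan {n r : ℕ} (s : Fin n → Fin r → ℤ) (J : Finset (Fin n)) :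
    Submodule ℚ (Fin r → ℚ) :=
  Submodule.span ℚ ((fun i => ratWeight (s i)) '' (J : Set (Fin n)))

/-- The sets `I 0, …, I l` form a partition of the set of indices (`I 0` may be empty), such that
the span of the weights is the direct sum of the spans of the weights in each block, the weights in
`I 0` are linearly independent, and, for `j ≥ 1`, the weights in `I j` span a space of dimension
`#(I j) - 1` and have `0` as a convex combination with positive coefficients. -/
structure IsBlockPartition {n r : ℕ} (s : Fin n → Fin r → ℤ) (l : ℕ)
    (I : Fin (l + 1) → Finset (Fin n)) : Prop where
  partition : ∀ i : Fin n, ∃! j : Fin (l + 1), i ∈ I j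
  span_eq : weightSpan s Finset.univ = ⨆ j, weightSpan s (I j)
  independent : iSupIndep fun j => weightSpan s (I j)
  finrank_zero : Module.finrank ℚ (weightSpan s (I 0)) = (I 0).card
  finrank_succ : ∀ j : Fin (l + 1), j ≠ 0 →
    Module.finrank ℚ (weightSpan s (I j)) + 1 = (I j).card
  zero_mem : ∀ j : Fin (l + 1), j ≠ 0 →
    (0 : Fin r → ℚ) ∈ openConvexHull ((I j).image fun i => ratWeight (s i))

end

end TorusRep

/-!
Let `R` be the space of rational linear relations between the weights. If the support of a nonzero
relation contained the support of no nonzero nonnegative relation, then every vector of `V` with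
that support would be nilpotent, and the relation would provide a nonconstant Laurent monomial in
the coordinates separating infinitely many of the orbits of these vectors. So visibility makes every
support contain a nonnegative one. By pure linear algebra over an ordered field, the nonnegative
relations of minimal support then have pairwise disjoint supports and form a basis of `R`: these
supports are the blocks `I 1, …, I l`.

Everything can be read off this basis of `R`. By duality, `𝔱 · x(1, …, 1)` consists of the vectors
whose coordinates in `I 0` vanish and whose coordinates in each other block are annihilated by the
relation of that block, hence `𝔠` is as claimed; its dimension is `l`. The monomials attached to
the relations of the blocks, scaled to have coprime integral coefficients, are algebraically
independent and generate the invariants, hence `V // T` is an affine space of dimension `l`.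
-/

namespace TorusRep

open Function

section PositiveCircuits

variable {F ι : Type*} [Field F]

theorem support_sub_smul_ssubset {d e : ι → F} (hed : support e ⊆ support d) {k : ι}
    (hk : e k ≠ 0) : support (d - (d k / e k) • e) ⊂ support d := by
  have hsub : support (d - (d k / e k) • e) ⊆ support d := fun i hi hdi => by
    have hei : e i = 0 := not_not.1 fun h => hed h hdi
    exact hi (by simp [hdi, hei])
  exact (Set.ssubset_iff_of_subset hsub).2 ⟨k, hed hk, by simp [hk]⟩

variable [LinearOrder F]

/-- A subspace `R` of `ι → F` in which the support of every nonzero vector contains the support of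
a nonzero vector with nonnegative coordinates. For the space of linear relations between the
weights of a representation, this is how visibility enters the proof. -/
def HasNonnegSupports (R : Submodule F (ι → F)) : Prop :=
  ∀ d ∈ R, d ≠ 0 → ∃ e ∈ R, e ≠ 0 ∧ 0 ≤ e ∧ support e ⊆ support d

/-- A circuit of a subspace `R` of `ι → F`, i.e. a nonzero vector of minimal support, with
nonnegative coordinates. -/
structure IsPositiveCircuit (R : Submodule F (ι → F)) (e : ι → F) : Prop where
  mem : e ∈ R
  ne_zero : e ≠ 0
  nonneg : 0 ≤ e
  support_subset : ∀ d ∈ R, d ≠ 0 → support d ⊆ support e → support e ⊆ support d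

variable {R : Submodule F (ι → F)} {e : ι → F}

theorem HasNonnegSupports.exists_isPositiveCircuit [Finite ι] (hR : HasNonnegSupports R)
    {d : ι → F} (hd : d ∈ R) {i : ι} (hi : d i ≠ 0) : ∃ e, IsPositiveCircuit R e ∧ e i ≠ 0 := by
  obtain ⟨_, ⟨m, hm, hmi, rfl⟩, hmin⟩ :=
    (Set.toFinite {A : Set ι | ∃ d ∈ R, d i ≠ 0 ∧ support d = A}).exists_minimal ⟨_, d, hd, hi, rfl⟩
  have apply_ne_zero : ∀ h ∈ R, h ≠ 0 → support h ⊆ support m → h i ≠ 0 := by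
    intro h hh h0 hsub hhi
    obtain ⟨k, hk⟩ := ne_iff.1 h0
    have hlt := support_sub_smul_ssubset hsub hk
    exact hlt.not_subset <| hmin ⟨_, R.sub_mem hm (R.smul_mem _ hh), by simpa [hhi] using hmi, rfl⟩
      hlt.subset
  obtain ⟨e, he, he0, hnn, hsub⟩ := hR m hm fun h => hmi (by simp [h])
  refine ⟨e, ⟨he, he0, hnn, fun d' hd' hd'0 hd'e => hsub.trans ?_⟩, apply_ne_zero e he he0 hsub⟩
  have hd'm := hd'e.trans hsub
  exact hmin ⟨d', hd', apply_ne_zero d' hd' hd'0 hd'm, rfl⟩ hd'm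

theorem IsPositiveCircuit.eq_zero_of_apply_eq_zero (he : IsPositiveCircuit R e) {d : ι → F}
    (hd : d ∈ R) (hsub : support d ⊆ support e) {a : ι} (hea : e a ≠ 0) (hda : d a = 0) :
    d = 0 := by
  by_contra hd0
  exact he.support_subset d hd hd0 hsub hea hda

variable [IsStrictOrderedRing F]

theorem exists_div_mul_le [Finite ι] (d : ι → F) {f : ι → F} {S : Set ι} (hS : S.Nonempty)
    (hf : ∀ i ∈ S, 0 < f i) : ∃ a ∈ S, ∀ i ∈ S, d a / f a * f i ≤ d i := by
  obtain ⟨a, ha, hmin⟩ := S.toFinite.exists_minimalFor (fun i => d i / f i) S hS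
  refine ⟨a, ha, fun i hi => (le_div_iff₀ (hf i hi)).1 ?_⟩
  exact (le_total _ _).elim id (hmin hi)

theorem exists_add_mul_nonpos [Finite ι] {d f : ι → F} {S : Set ι} (hd : ∀ i ∈ S, d i ≤ 0)
    (hf : 0 ≤ f) (hS : ∃ i ∈ S, f i ≠ 0) :
    ∃ q, 0 ≤ q ∧ (∃ k ∈ S, f k ≠ 0 ∧ d k + q * f k = 0) ∧ ∀ i ∈ S, d i + q * f i ≤ 0 := by
  obtain ⟨k, ⟨hkS, hfk⟩, hmin⟩ := exists_div_mul_le (-d) (S := {i | i ∈ S ∧ f i ≠ 0}) hS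
    fun i hi => (hf i).lt_of_ne' hi.2
  simp only [Pi.neg_apply] at hmin
  refine ⟨-d k / f k, div_nonneg (neg_nonneg.2 (hd k hkS)) (hf k),
    ⟨k, hkS, hfk, by rw [div_mul_cancel₀ _ hfk, add_neg_cancel]⟩, fun i hi => ?_⟩
  rcases eq_or_ne (f i) 0 with hfi | hfi
  · simpa [hfi] using hd i hi
  · linarith [hmin i ⟨hi, hfi⟩]

/-- Subtracting a multiple of `e` makes `d` nonnegative on the support of `e`, with a zero there.
If `d` is not yet zero on that support, a nonnegative vector of `R` whose support is contained in
that of `d` cancels one of the negative coordinates of `d`. -/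
theorem IsPositiveCircuit.exists_eq_mul_of_nonpos [Finite ι] (he : IsPositiveCircuit R e)
    (hR : HasNonnegSupports R) {d : ι → F} (hd : d ∈ R) (hneg : ∀ i, e i = 0 → d i ≤ 0) :
    ∃ c, ∀ i, e i ≠ 0 → d i = c * e i := by
  induction hN : support d \ support e using WellFoundedLT.induction generalizing d with
  | ind N IH =>
  subst hN
  obtain ⟨a, hea, hmin⟩ := exists_div_mul_le d (support_nonempty_iff.2 he.ne_zero)
    fun i hi => (he.nonneg i).lt_of_ne' hi
  set d' := d - (d a / e a) • e with hd'_def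
  have hd' : d' ∈ R := R.sub_mem hd (R.smul_mem _ he.mem)
  have hd'_off : ∀ i, e i = 0 → d' i = d i := fun i hi => by simp [hd'_def, hi]
  have hd'a : d' a = 0 := by simp [hd'_def, div_mul_cancel₀ _ hea]
  suffices h0 : ∀ i, e i ≠ 0 → d' i ≤ 0 from
    ⟨d a / e a, fun i hi => le_antisymm (by simpa [hd'_def] using h0 i hi) (hmin i hi)⟩
  rcases eq_or_ne d' 0 with h | h
  · simp [h]
  obtain ⟨f, hf, hf0, hf_nonneg, hfsub⟩ := hR d' hd' h
  have hfa : f a = 0 := not_not.1 fun h => hfsub h hd'a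
  have hoff : ∃ i ∈ {i | e i = 0}, f i ≠ 0 := by
    by_contra! hempty
    exact hf0 (he.eq_zero_of_apply_eq_zero hf (fun i hfi hei => hfi (hempty i hei)) hea hfa)
  obtain ⟨q, hq, ⟨k, hek, hfk, hk⟩, hle⟩ := exists_add_mul_nonpos
    (fun i hi => (hd'_off i hi).trans_le (hneg i hi)) hf_nonneg hoff
  have hsub : support (d' + q • f) \ support e ⊆ support d \ support e := fun i hi => by
    refine ⟨fun hdi => hi.1 ?_, hi.2⟩
    have hd'i : d' i = 0 := (hd'_off i (not_not.1 hi.2)).trans hdi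
    have hfi : f i = 0 := not_not.1 fun h => hfsub h hd'i
    simp [hd'i, hfi]
  have hssub := (Set.ssubset_iff_of_subset hsub).2
    ⟨k, ⟨fun h => hfsub hfk ((hd'_off k hek).trans h), not_not.2 hek⟩, fun h => h.1 hk⟩
  obtain ⟨c, hc⟩ := IH _ hssub (R.add_mem hd' (R.smul_mem _ hf)) hle rfl
  have hc0 : c = 0 := by
    simpa [hd'a, hfa, (show e a ≠ 0 from hea)] using (hc a hea).symm
  intro i hi
  have hdi : d' i + q * f i = 0 := by simpa [hc0] using hc i hi
  linarith [mul_nonneg hq (hf_nonneg i)]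

theorem IsPositiveCircuit.exists_eq_mul [Finite ι] (he : IsPositiveCircuit R e)
    (hR : HasNonnegSupports R) {d : ι → F} (hd : d ∈ R) : ∃ c, ∀ i, e i ≠ 0 → d i = c * e i := by
  induction hN : support d using WellFoundedLT.induction generalizing d with
  | ind N IH =>
  subst hN
  rcases eq_or_ne d 0 with rfl | hd0
  · exact ⟨0, by simp⟩
  obtain ⟨f, hf, hf0, hfnn, hsub⟩ := hR d hd hd0
  obtain ⟨k, hk⟩ := ne_iff.1 hf0
  obtain ⟨c, hc⟩ := IH _ (support_sub_smul_ssubset hsub hk) (R.sub_mem hd (R.smul_mem _ hf)) rfl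
  obtain ⟨q, hq⟩ := he.exists_eq_mul_of_nonpos hR (R.neg_mem hf) fun i _ => by simpa using hfnn i
  refine ⟨c - d k / f k * q, fun i hi => ?_⟩
  have hci := hc i hi
  have hqi := hq i hi
  simp only [Pi.sub_apply, Pi.smul_apply, smul_eq_mul, Pi.neg_apply] at hci hqi
  linear_combination hci - d k / f k * hqi

theorem IsPositiveCircuit.support_eq [Finite ι] (hR : HasNonnegSupports R) {e e' : ι → F}
    (he : IsPositiveCircuit R e) (he' : IsPositiveCircuit R e') {i : ι} (hi : e i ≠ 0)
    (hi' : e' i ≠ 0) : support e = support e' := by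
  have support_subset : ∀ {e e' : ι → F}, IsPositiveCircuit R e → IsPositiveCircuit R e' → e i ≠ 0 →
      e' i ≠ 0 → support e ⊆ support e' := by
    intro e e' he he' hi hi' k hk
    obtain ⟨c, hc⟩ := he.exists_eq_mul hR he'.mem
    have hc0 : c ≠ 0 := left_ne_zero_of_mul (hc i hi ▸ hi')
    simpa [hc k hk, hc0] using hk
  exact (support_subset he he' hi hi').antisymm (support_subset he' he hi' hi)

end PositiveCircuits

section CircuitPartitions

theorem sum_eq_sum_sum_of_existsUnique {ι κ M : Type*} [Fintype ι] [Fintype κ] [AddCommMonoid M]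
    {I : κ → Finset ι} (hI : ∀ i, ∃! j, i ∈ I j) (f : ι → M) :
    ∑ i, f i = ∑ j, ∑ i ∈ I j, f i := by
  classical
  have hdisj : Set.PairwiseDisjoint (Set.univ : Set κ) I := fun j _ k _ hjk =>
    Finset.disjoint_left.2 fun i hj hk => hjk ((hI i).unique hj hk)
  rw [← Finset.sum_biUnion (by simpa using hdisj)]
  exact Finset.sum_congr (by ext i; simpa using (hI i).exists) fun _ _ => rfl

variable {F ι : Type*} [Field F] [LinearOrder F]

/-- A partition of the index set adapted to a subspace `R` of `ι → F`: the elements of `R` are the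
vectors which vanish on `I 0` and are proportional to the positive vector `e` on each of the other
blocks. -/
structure IsCircuitPartition (R : Submodule F (ι → F)) {l : ℕ} (I : Fin (l + 1) → Finset ι)
    (e : ι → F) : Prop where
  partition : ∀ i, ∃! j, i ∈ I j
  nonempty : ∀ j : Fin l, (I j.succ).Nonempty
  pos : ∀ j : Fin l, ∀ i ∈ I j.succ, 0 < e i
  mem_iff : ∀ d, d ∈ R ↔ (∀ i ∈ I 0, d i = 0) ∧ ∀ j : Fin l, ∃ c, ∀ i ∈ I j.succ, d i = c * e i

variable {R : Submodule F (ι → F)}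

theorem exists_mem_succ_of_notMem_zero {l : ℕ} {I : Fin (l + 1) → Finset ι}
    (hI : ∀ i, ∃! j, i ∈ I j) {i : ι} (hi : i ∉ I 0) : ∃ j : Fin l, i ∈ I j.succ := by
  obtain ⟨j, hj, -⟩ := hI i
  cases j using Fin.cases with
  | zero => exact absurd hj hi
  | succ j => exact ⟨j, hj⟩

section Existence

variable [Finite ι]

theorem exists_partition_of_disjoint {l : ℕ} {A : Fin l → Set ι}
    (hA : ∀ i j k, i ∈ A j → i ∈ A k → j = k) :
    ∃ I : Fin (l + 1) → Finset ι, (∀ i, ∃! j, i ∈ I j) ∧ (∀ i, i ∈ I 0 ↔ ∀ j, i ∉ A j) ∧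
      ∀ i j, i ∈ I j.succ ↔ i ∈ A j := by
  classical
  have := Fintype.ofFinite ι
  let I : Fin (l + 1) → Finset ι :=
    Fin.cons (Finset.univ.filter fun i => ∀ j, i ∉ A j) fun j => Finset.univ.filter (· ∈ A j)
  have mem_zero : ∀ i, i ∈ I 0 ↔ ∀ j, i ∉ A j := by simp [I]
  have mem_succ : ∀ i (j : Fin l), i ∈ I j.succ ↔ i ∈ A j := by simp [I]
  refine ⟨I, fun i => ?_, mem_zero, mem_succ⟩
  by_cases hi : ∃ j, i ∈ A j
  · obtain ⟨j, hj⟩ := hi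
    refine ⟨j.succ, (mem_succ i j).2 hj, fun k hk => ?_⟩
    cases k using Fin.cases with
    | zero => exact absurd hj ((mem_zero i).1 hk j)
    | succ k => exact congrArg Fin.succ (hA i k j ((mem_succ i k).1 hk) hj)
  · push Not at hi
    refine ⟨0, (mem_zero i).2 hi, fun k hk => ?_⟩
    cases k using Fin.cases with
    | zero => rfl
    | succ k => exact absurd ((mem_succ i k).1 hk) (hi k)

variable [IsStrictOrderedRing F]

theorem HasNonnegSupports.exists_positiveCircuits (hR : HasNonnegSupports R) :
    ∃ (l : ℕ) (c : Fin l → ι → F), (∀ j, IsPositiveCircuit R (c j)) ∧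
      (∀ d ∈ R, ∀ i, d i ≠ 0 → ∃ j, c j i ≠ 0) ∧ ∀ i j k, c j i ≠ 0 → c k i ≠ 0 → j = k := by
  obtain ⟨l, ⟨f⟩⟩ := Finite.exists_equiv_fin {A | ∃ e, IsPositiveCircuit R e ∧ support e = A}
  choose c hc hsupp using fun j : Fin l => (f.symm j).2
  refine ⟨l, c, hc, fun d hd i hi => ?_, fun i j k hj hk => f.symm.injective (Subtype.ext ?_)⟩
  · obtain ⟨e, he, hei⟩ := hR.exists_isPositiveCircuit hd hi
    refine ⟨f ⟨_, e, he, rfl⟩, ?_⟩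
    rwa [← mem_support, hsupp, Equiv.symm_apply_apply]
  · rw [← hsupp, ← hsupp, (hc j).support_eq hR (hc k) hj hk]

theorem HasNonnegSupports.exists_isCircuitPartition (hR : HasNonnegSupports R) :
    ∃ (l : ℕ) (I : Fin (l + 1) → Finset ι) (e : ι → F), IsCircuitPartition R I e := by
  obtain ⟨l, c, hc, hcover, hdisj⟩ := hR.exists_positiveCircuits
  have sum_eq : ∀ (q : Fin l → F) {j i}, c j i ≠ 0 → (∑ k, q k • c k) i = q j * c j i := by
    intro q j i hi
    rw [Finset.sum_apply, Finset.sum_eq_single j _ (by simp), Pi.smul_apply, smul_eq_mul]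
    exact fun k _ hk => mul_eq_zero_of_right _ <| not_not.1 fun hki => hk (hdisj i k j hki hi)
  obtain ⟨I, hI, mem_zero, mem_succ⟩ :=
    exists_partition_of_disjoint (A := fun j => {i | c j i ≠ 0}) hdisj
  simp only [Set.mem_ofPred_eq, not_not] at mem_zero mem_succ
  refine ⟨l, I, ∑ j, (1 : F) • c j, hI, fun j => ?_, fun j i hi => ?_, fun d => ⟨fun hd =>
    ⟨fun i hi => ?_, fun j => ?_⟩, fun ⟨hd0, hd⟩ => ?_⟩⟩
  · obtain ⟨i, hi⟩ := ne_iff.1 (hc j).ne_zero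
    exact ⟨i, (mem_succ i j).2 hi⟩
  · rw [mem_succ] at hi
    rw [sum_eq _ hi, one_mul]
    exact ((hc j).nonneg i).lt_of_ne' hi
  · by_contra hdi
    obtain ⟨j, hj⟩ := hcover d hd i hdi
    exact hj ((mem_zero i).1 hi j)
  · obtain ⟨q, hq⟩ := (hc j).exists_eq_mul hR hd
    refine ⟨q, fun i hi => ?_⟩
    rw [mem_succ] at hi
    rw [sum_eq _ hi, one_mul, hq i hi]
  · choose q hq using hd
    have hdq : d = ∑ j, q j • c j := by
      ext i
      by_cases hi : ∃ j, c j i ≠ 0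
      · obtain ⟨j, hj⟩ := hi
        rw [hq j i ((mem_succ i j).2 hj), sum_eq _ hj, sum_eq _ hj, one_mul]
      · push Not at hi
        simp [hd0 i ((mem_zero i).2 hi), hi]
    exact hdq ▸ R.sum_mem fun j _ => R.smul_mem _ (hc j).mem

end Existence

namespace IsCircuitPartition

variable {l : ℕ} {I : Fin (l + 1) → Finset ι} {e : ι → F}

theorem indicator_mem [DecidableEq ι] (h : IsCircuitPartition R I e) (j : Fin l) :
    (fun i => if i ∈ I j.succ then e i else 0) ∈ R := by
  refine (h.mem_iff _).2 ⟨fun i hi => if_neg fun hij => ?_,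
    fun k => ⟨if k = j then 1 else 0, fun i hi => ?_⟩⟩
  · exact (Fin.succ_ne_zero j) ((h.partition i).unique hij hi)
  · have hik : i ∈ I j.succ ↔ k = j :=
      ⟨fun hij => Fin.succ_injective _ ((h.partition i).unique hi hij), fun hkj => hkj ▸ hi⟩
    simp [hik]

theorem apply_of_forall_dual {W : Type*} [AddCommGroup W] [Module F W]
    (h : IsCircuitPartition R I e) {d : ι → W}
    (hd : ∀ φ : Module.Dual F W, (fun i => φ (d i)) ∈ R) :
    (∀ i ∈ I 0, d i = 0) ∧ ∀ j : Fin l, ∃ w : W, ∀ i ∈ I j.succ, d i = e i • w := by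
  refine ⟨fun i hi => (Module.forall_dual_apply_eq_zero_iff F _).1 fun φ =>
    ((h.mem_iff _).1 (hd φ)).1 i hi, fun j => ?_⟩
  obtain ⟨a, ha⟩ := h.nonempty j
  have hea := (h.pos j a ha).ne'
  refine ⟨(e a)⁻¹ • d a, fun i hi => sub_eq_zero.1 <|
    (Module.forall_dual_apply_eq_zero_iff F _).1 fun φ => ?_⟩
  obtain ⟨c, hc⟩ := ((h.mem_iff _).1 (hd φ)).2 j
  simp only [map_sub, map_smul, smul_eq_mul, hc i hi, hc a ha]
  field_simp
  ring

end IsCircuitPartition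

end CircuitPartitions

section Spans

variable {F ι κ W : Type*} [Field F] [AddCommGroup W] [Module F W] {f : ι → W}

theorem exists_eq_on_blocks {X : Type*} {I : κ → Finset ι} (hI : ∀ i, ∃! j, i ∈ I j)
    (d : κ → ι → X) :
    ∃ d' : ι → X, ∀ j, ∀ i ∈ I j, d' i = d j i := by
  choose blk _ huniq using hI
  exact ⟨fun i => d (blk i) i, fun j i hi => by rw [huniq i j hi]⟩

theorem iSupIndep_span_image_iff [Fintype ι] [Finite κ] {I : κ → Finset ι}
    (hI : ∀ i, ∃! j, i ∈ I j) :
    (iSupIndep fun j => Submodule.span F (f '' (I j : Set ι))) ↔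
      ∀ d : ι → F, ∑ i, d i • f i = 0 → ∀ j, ∑ i ∈ I j, d i • f i = 0 := by
  classical
  have := Fintype.ofFinite κ
  simp only [iSupIndep_iff_finsetSum_eq_zero_imp_eq_zero,
    Submodule.mem_span_image_finset_iff_exists_fun']
  constructor
  · intro h d hd j
    rw [sum_eq_sum_sum_of_existsUnique hI] at hd
    exact h Finset.univ _ (fun j _ => ⟨d, rfl⟩) hd j (Finset.mem_univ j)
  · intro h S v hv hsum j hj
    have hex : ∀ j, ∃ d : ι → F, ∑ i ∈ I j, d i • f i = if j ∈ S then v j else 0 := fun j => by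
      split_ifs with hj
      exacts [hv j hj, ⟨0, by simp⟩]
    choose d hd using hex
    obtain ⟨d', hd'⟩ := exists_eq_on_blocks hI d
    have hblock : ∀ j, ∑ i ∈ I j, d' i • f i = if j ∈ S then v j else 0 := fun j =>
      (Finset.sum_congr rfl fun i hi => by rw [hd' j i hi]).trans (hd j)
    have hzero : ∑ i, d' i • f i = 0 := by
      simpa [sum_eq_sum_sum_of_existsUnique hI, hblock, Finset.sum_ite_mem] using hsum
    simpa [hj] using (hblock j).symm.trans (h d' hzero j)

theorem finrank_span_image_eq_card_iff {J : Finset ι} :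
    Module.finrank F (Submodule.span F (f '' (J : Set ι))) = J.card ↔
      ∀ d : ι → F, ∑ i ∈ J, d i • f i = 0 → ∀ i ∈ J, d i = 0 := by
  rw [← linearIndepOn_finset_iff, LinearIndepOn, linearIndependent_iff_card_eq_finrank_span,
    Set.finrank, Set.image_eq_range, eq_comm]
  simp

theorem finrank_span_image_add_one_eq_card_iff {J : Finset ι} {e : ι → F} (hJ : J.Nonempty)
    (he : ∀ i ∈ J, e i ≠ 0) (hsum : ∑ i ∈ J, e i • f i = 0) :
    Module.finrank F (Submodule.span F (f '' (J : Set ι))) + 1 = J.card ↔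
      ∀ d : ι → F, ∑ i ∈ J, d i • f i = 0 → ∃ c, ∀ i ∈ J, d i = c * e i := by
  classical
  obtain ⟨a, ha⟩ := hJ
  have hfa : f a = ∑ i ∈ J.erase a, (-(e i / e a)) • f i := by
    rw [← Finset.add_sum_erase J _ ha, add_comm] at hsum
    simp only [neg_smul, div_eq_inv_mul, mul_smul, Finset.sum_neg_distrib, ← Finset.smul_sum]
    rw [eq_neg_of_add_eq_zero_left hsum, smul_neg, neg_neg, inv_smul_smul₀ (he a ha)]
  have hspan : Submodule.span F (f '' (J : Set ι)) =
      Submodule.span F (f '' (J.erase a : Set ι)) := by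
    rw [← Finset.insert_erase ha, Finset.coe_insert, Set.image_insert_eq,
      Finset.erase_insert (Finset.notMem_erase a J)]
    exact Submodule.span_insert_eq_span <|
      (Submodule.mem_span_image_finset_iff_exists_fun' F).2 ⟨_, hfa.symm⟩
  rw [hspan, ← Finset.card_erase_add_one ha, Nat.add_right_cancel_iff,
    finrank_span_image_eq_card_iff]
  constructor
  · intro h d hd
    refine ⟨d a / e a, fun i hi => ?_⟩
    have hsub : ∑ k ∈ J, (d k - d a / e a * e k) • f k = 0 := by
      simp only [sub_smul, mul_smul, Finset.sum_sub_distrib, ← Finset.smul_sum, hd, hsum,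
        smul_zero, sub_zero]
    rcases eq_or_ne i a with rfl | hia
    · rw [div_mul_cancel₀ _ (he i hi)]
    · rw [← Finset.add_sum_erase J _ ha, div_mul_cancel₀ _ (he a ha), sub_self, zero_smul,
        zero_add] at hsub
      exact sub_eq_zero.1 (h _ hsub i (Finset.mem_erase.2 ⟨hia, hi⟩))
  · intro h d hd i hi
    have hupd : ∑ k ∈ J, update d a 0 k • f k = 0 := by
      rw [← Finset.add_sum_erase J _ ha, update_self, zero_smul, zero_add, ← hd]
      exact Finset.sum_congr rfl fun k hk => by rw [update_of_ne (Finset.ne_of_mem_erase hk)]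
    obtain ⟨c, hc⟩ := h _ hupd
    have hca : c = 0 := by simpa [he a ha] using (hc a ha).symm
    simpa [update_of_ne (Finset.ne_of_mem_erase hi), hca] using hc i (Finset.mem_of_mem_erase hi)

end Spans

section OpenConvexHull

variable {ι : Type*} {r : ℕ} {f : ι → Fin r → ℚ} {J : Finset ι}

theorem zero_mem_openConvexHull_image (hJ : J.Nonempty) {e : ι → ℚ} (he : ∀ i ∈ J, 0 < e i)
    (hsum : ∑ i ∈ J, e i • f i = 0) : (0 : Fin r → ℚ) ∈ openConvexHull (J.image f) := by
  have hE : 0 < ∑ i ∈ J, e i := Finset.sum_pos he hJ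
  have hmaps : ∀ i ∈ J, f i ∈ J.image f := fun i hi => Finset.mem_image_of_mem f hi
  refine ⟨fun a => (∑ i ∈ J with f i = a, e i) / ∑ i ∈ J, e i, ?_, ?_, ?_⟩
  · intro a ha
    obtain ⟨i, hi, rfl⟩ := Finset.mem_image.1 ha
    refine div_pos (Finset.sum_pos (fun k hk => he k (Finset.mem_filter.1 hk).1) ?_) hE
    exact ⟨i, by simp [hi]⟩
  · rw [← Finset.sum_div, Finset.sum_fiberwise_of_maps_to hmaps, div_self hE.ne']
  · simp_rw [div_eq_inv_mul, mul_smul, ← Finset.smul_sum, Finset.sum_smul]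
    rw [← smul_zero (∑ i ∈ J, e i)⁻¹, ← hsum,
      ← Finset.sum_fiberwise_of_maps_to hmaps fun i => e i • f i]
    congr 1
    refine Finset.sum_congr rfl fun a _ => Finset.sum_congr rfl fun i hi => ?_
    rw [(Finset.mem_filter.1 hi).2]

theorem exists_pos_of_zero_mem_openConvexHull_image
    (h : (0 : Fin r → ℚ) ∈ openConvexHull (J.image f)) :
    ∃ e : ι → ℚ, (∀ i ∈ J, 0 < e i) ∧ ∑ i ∈ J, e i • f i = 0 := by
  obtain ⟨α, hpos, -, hsum⟩ := h
  have hcard : ∀ i ∈ J, 0 < (J.filter fun k => f k = f i).card :=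
    fun i hi => Finset.card_pos.2 ⟨i, by simp [hi]⟩
  refine ⟨fun i => α (f i) / (J.filter fun k => f k = f i).card, fun i hi => ?_, ?_⟩
  · exact div_pos (hpos _ (Finset.mem_image_of_mem _ hi)) (by exact_mod_cast hcard i hi)
  · rw [Finset.sum_comp (fun a => (α a / (J.filter fun k => f k = a).card : ℚ) • a) f, ← hsum]
    refine Finset.sum_congr rfl fun a ha => ?_
    obtain ⟨i, hi, rfl⟩ := Finset.mem_image.1 ha
    rw [← Nat.cast_smul_eq_nsmul ℚ, smul_smul,
      mul_div_cancel₀ _ (by exact_mod_cast (hcard i hi).ne')]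

end OpenConvexHull

section BlockPartitions

variable {n r l : ℕ} {s : Fin n → Fin r → ℤ} {I : Fin (l + 1) → Finset (Fin n)} {e : Fin n → ℚ}

/-- The space of rational linear relations between the weights `s i`. -/
def weightRelations (s : Fin n → Fin r → ℤ) : Submodule ℚ (Fin n → ℚ) :=
  LinearMap.ker (Fintype.linearCombination ℚ fun i => ratWeight (s i))

theorem mem_weightRelations {d : Fin n → ℚ} :
    d ∈ weightRelations s ↔ ∑ i, d i • ratWeight (s i) = 0 :=
  Iff.rfl

theorem IsBlockPartition.exists_isCircuitPartition (h : IsBlockPartition s l I) :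
    ∃ e, IsCircuitPartition (weightRelations s) I e := by
  have hsucc : ∀ j : Fin l, ∃ e : Fin n → ℚ, (∀ i ∈ I j.succ, 0 < e i) ∧
      ∑ i ∈ I j.succ, e i • ratWeight (s i) = 0 := fun j =>
    exists_pos_of_zero_mem_openConvexHull_image (h.zero_mem _ j.succ_ne_zero)
  choose c hc hsum using hsucc
  obtain ⟨e, he⟩ := exists_eq_on_blocks h.partition (Fin.cons 0 c)
  have he_succ : ∀ j : Fin l, ∀ i ∈ I j.succ, e i = c j i := fun j => he j.succ
  have hpos : ∀ j : Fin l, ∀ i ∈ I j.succ, 0 < e i := fun j i hi => he_succ j i hi ▸ hc j i hi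
  have hrel : ∀ j : Fin l, ∑ i ∈ I j.succ, e i • ratWeight (s i) = 0 := fun j =>
    (Finset.sum_congr rfl fun i hi => by rw [he_succ j i hi]).trans (hsum j)
  have hne : ∀ j : Fin l, (I j.succ).Nonempty := fun j =>
    Finset.card_pos.1 (by have := h.finrank_succ _ j.succ_ne_zero; omega)
  refine ⟨e, h.partition, hne, hpos, fun d => ⟨fun hd => ?_, fun ⟨hd0, hd⟩ => ?_⟩⟩
  · have hblock := (iSupIndep_span_image_iff h.partition).1 h.independent d hd
    exact ⟨finrank_span_image_eq_card_iff.1 h.finrank_zero d (hblock 0), fun j =>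
      (finrank_span_image_add_one_eq_card_iff (hne j) (fun i hi => (hpos j i hi).ne') (hrel j)).1
        (h.finrank_succ _ j.succ_ne_zero) d (hblock j.succ)⟩
  · rw [mem_weightRelations, sum_eq_sum_sum_of_existsUnique h.partition, Fin.sum_univ_succ,
      Finset.sum_eq_zero fun i hi => by rw [hd0 i hi, zero_smul], zero_add]
    refine Finset.sum_eq_zero fun j _ => ?_
    obtain ⟨q, hq⟩ := hd j
    rw [Finset.sum_congr rfl fun i hi => by rw [hq i hi, mul_smul], ← Finset.smul_sum, hrel,
      smul_zero]

theorem exists_mem_weightRelations_eqOn {J : Finset (Fin n)} {d : Fin n → ℚ}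
    (hd : ∑ i ∈ J, d i • ratWeight (s i) = 0) :
    ∃ d' ∈ weightRelations s, ∀ i ∈ J, d' i = d i := by
  refine ⟨fun i => if i ∈ J then d i else 0, ?_, fun i hi => if_pos hi⟩
  simpa [mem_weightRelations, ite_smul, Finset.sum_ite_mem] using hd

namespace IsCircuitPartition

theorem sum_smul_eq_zero (h : IsCircuitPartition (weightRelations s) I e) (j : Fin l) :
    ∑ i ∈ I j.succ, e i • ratWeight (s i) = 0 := by
  simpa [mem_weightRelations, ite_smul, Finset.sum_ite_mem] using h.indicator_mem j

theorem sum_block_eq_zero (h : IsCircuitPartition (weightRelations s) I e) {d : Fin n → ℚ}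
    (hd : d ∈ weightRelations s) (j : Fin (l + 1)) : ∑ i ∈ I j, d i • ratWeight (s i) = 0 := by
  obtain ⟨hd0, hd⟩ := (h.mem_iff d).1 hd
  cases j using Fin.cases with
  | zero => exact Finset.sum_eq_zero fun i hi => by rw [hd0 i hi, zero_smul]
  | succ j =>
    obtain ⟨c, hc⟩ := hd j
    rw [Finset.sum_congr rfl fun i hi => by rw [hc i hi, mul_smul], ← Finset.smul_sum,
      h.sum_smul_eq_zero, smul_zero]

theorem isBlockPartition (h : IsCircuitPartition (weightRelations s) I e) :
    IsBlockPartition s l I where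
  partition := h.partition
  span_eq := by
    simp_rw [weightSpan]
    rw [← Submodule.span_iUnion, ← Set.image_iUnion]
    congr 2
    ext i
    simpa using (h.partition i).exists
  independent := (iSupIndep_span_image_iff h.partition).2 fun _ hd => h.sum_block_eq_zero hd
  finrank_zero := by
    refine finrank_span_image_eq_card_iff.2 fun d hd i hi => ?_
    obtain ⟨d', hd', heq⟩ := exists_mem_weightRelations_eqOn hd
    rw [← heq i hi, ((h.mem_iff d').1 hd').1 i hi]
  finrank_succ := fun j hj => by
    obtain ⟨j, rfl⟩ := Fin.exists_succ_eq.2 hj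
    refine (finrank_span_image_add_one_eq_card_iff (h.nonempty j)
      (fun i hi => (h.pos j i hi).ne') (h.sum_smul_eq_zero j)).2 fun d hd => ?_
    obtain ⟨d', hd', heq⟩ := exists_mem_weightRelations_eqOn hd
    obtain ⟨c, hc⟩ := ((h.mem_iff d').1 hd').2 j
    exact ⟨c, fun i hi => by rw [← heq i hi, hc i hi]⟩
  zero_mem := fun j hj => by
    obtain ⟨j, rfl⟩ := Fin.exists_succ_eq.2 hj
    exact zero_mem_openConvexHull_image (h.nonempty j) (h.pos j) (h.sum_smul_eq_zero j)

end IsCircuitPartition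

end BlockPartitions

section Integrality

theorem exists_nat_multiples {ι : Type*} (J : Finset ι) {e : ι → ℚ} (he : ∀ i ∈ J, 0 < e i) :
    ∃ (N : ℕ) (u : ι → ℕ), N ≠ 0 ∧ ∀ i ∈ J, (u i : ℚ) = N * e i := by
  obtain ⟨N, hN⟩ := IsLocalization.exist_integer_multiples (nonZeroDivisors ℤ) J e
  choose! u hu using hN
  refine ⟨(N : ℤ).natAbs, fun i => (u i).natAbs,
    Int.natAbs_ne_zero.2 (nonZeroDivisors.coe_ne_zero N), fun i hi => ?_⟩
  have hui : (u i : ℚ) = (N : ℤ) * e i := by simpa using hu i hi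
  rw [Nat.cast_natAbs, Nat.cast_natAbs, Int.cast_abs, Int.cast_abs, hui, abs_mul,
    abs_of_pos (he i hi)]

theorem exists_eq_natCast_mul_of_gcd_eq_one {ι : Type*} {J : Finset ι} {a g : ι → ℕ}
    (hg : J.gcd g = 1) {q : ℚ} (hq : 0 ≤ q) (h : ∀ i ∈ J, (a i : ℚ) = q * g i) :
    ∃ k : ℕ, ∀ i ∈ J, a i = k * g i := by
  have hmul : ∀ i ∈ J, a i * q.den = q.num.natAbs * g i := fun i hi => by
    have hnum : (q.num.natAbs : ℚ) = q.num := by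
      rw [Nat.cast_natAbs, abs_of_nonneg (Rat.num_nonneg.2 hq)]
    have hden : (a i : ℚ) * q.den = q.num.natAbs * g i := by
      rw [h i hi, hnum, ← Rat.mul_den_eq_num q]
      ring
    exact_mod_cast hden
  have hone : q.den ∣ J.gcd g := Finset.dvd_gcd fun i hi =>
    q.reduced.symm.dvd_of_dvd_mul_left (hmul i hi ▸ dvd_mul_left _ _)
  rw [hg, Nat.dvd_one] at hone
  exact ⟨q.num.natAbs, fun i hi => by rw [← hmul i hi, hone, mul_one]⟩

/-- `c` is the multiple of `e` whose coordinates on `J` are coprime integers. -/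
theorem exists_primitive_multiple {ι : Type*} {J : Finset ι} (hJ : J.Nonempty) {e : ι → ℚ}
    (he : ∀ i ∈ J, 0 < e i) :
    ∃ c : ι → ℕ, (∀ i, c i ≠ 0 ↔ i ∈ J) ∧ (∃ q : ℚ, ∀ i ∈ J, (c i : ℚ) = q * e i) ∧
      ∀ (a : ι → ℕ) (p : ℚ), (∀ i ∈ J, (a i : ℚ) = p * e i) → ∃ k, ∀ i ∈ J, a i = k * c i := by
  classical
  obtain ⟨N, u, hN, hu⟩ := exists_nat_multiples J he
  obtain ⟨g, hg, hgcd⟩ := J.extract_gcd u hJ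
  have hN' : (0 : ℚ) < N := by exact_mod_cast hN.bot_lt
  have hNe : ∀ i ∈ J, (N : ℚ) * e i = J.gcd u * g i := fun i hi => by
    rw [← hu i hi, hg i hi, Nat.cast_mul]
  have hdvd : (0 : ℚ) < J.gcd u := by
    obtain ⟨i, hi⟩ := hJ
    refine Nat.cast_pos.2 (Nat.pos_of_ne_zero fun h0 => (mul_pos hN' (he i hi)).ne' ?_)
    rw [hNe i hi, h0, Nat.cast_zero, zero_mul]
  obtain ⟨c, hc, hc_off⟩ : ∃ c : ι → ℕ, (∀ i ∈ J, c i = g i) ∧ ∀ i ∉ J, c i = 0 :=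
    ⟨fun i => if i ∈ J then g i else 0, fun i hi => if_pos hi, fun i hi => if_neg hi⟩
  have hgpos : ∀ i ∈ J, (g i : ℚ) = N / J.gcd u * e i := fun i hi => by
    rw [div_mul_eq_mul_div, hNe i hi, mul_div_cancel_left₀ _ hdvd.ne']
  refine ⟨c, fun i => ⟨fun h => not_not.1 (mt (hc_off i) h), fun hi => ?_⟩,
    ⟨N / J.gcd u, fun i hi => by rw [hc i hi, hgpos i hi]⟩, fun a p ha => ?_⟩
  · have hgi : (g i : ℚ) ≠ 0 := hgpos i hi ▸ (mul_pos (div_pos hN' hdvd) (he i hi)).ne'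
    rw [hc i hi]
    exact_mod_cast hgi
  · have hp : 0 ≤ p := by
      obtain ⟨i, hi⟩ := hJ
      exact nonneg_of_mul_nonneg_left (ha i hi ▸ Nat.cast_nonneg (a i)) (he i hi)
    obtain ⟨k, hk⟩ := exists_eq_natCast_mul_of_gcd_eq_one (a := a) (q := p * (J.gcd u / N)) hgcd
      (by positivity) fun i hi => by rw [ha i hi, hgpos i hi]; field_simp
    exact ⟨k, fun i hi => by rw [hc i hi, hk i hi]⟩

variable {n r l : ℕ} {s : Fin n → Fin r → ℤ} {I : Fin (l + 1) → Finset (Fin n)} {e : Fin n → ℚ}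

theorem natCast_mem_weightRelations {a : Fin n → ℕ} :
    (fun i => (a i : ℚ)) ∈ weightRelations s ↔ ∑ i, a i • s i = 0 := by
  simp only [mem_weightRelations, funext_iff, Finset.sum_apply, Pi.smul_apply, ratWeight,
    smul_eq_mul, Pi.zero_apply, nsmul_eq_mul]
  exact forall_congr' fun j => by exact_mod_cast Iff.rfl

theorem IsCircuitPartition.exists_primitiveCircuits
    (h : IsCircuitPartition (weightRelations s) I e) :
    ∃ c : Fin l → Fin n → ℕ, (∀ j i, c j i ≠ 0 ↔ i ∈ I j.succ) ∧ (∀ j, ∑ i, c j i • s i = 0) ∧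
      ∀ a : Fin n → ℕ, ∑ i, a i • s i = 0 → ∃ k : Fin l → ℕ, a = ∑ j, k j • c j := by
  choose c hc hce hprim using fun j : Fin l => exists_primitive_multiple (h.nonempty j) (h.pos j)
  have hoff : ∀ {i} {j k : Fin l}, i ∈ I j.succ → k ≠ j → c k i = 0 := fun {i j k} hi hkj =>
    not_not.1 fun hk => hkj <|
      Fin.succ_injective _ ((h.partition i).unique ((hc k i).1 hk) hi)
  have hzero : ∀ {i}, i ∈ I 0 → ∀ j, c j i = 0 := fun {i} hi j =>
    not_not.1 fun hj => j.succ_ne_zero ((h.partition i).unique ((hc j i).1 hj) hi)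
  refine ⟨c, hc, fun j => natCast_mem_weightRelations.1 <| (h.mem_iff _).2
    ⟨fun i hi => by simp [hzero hi], fun k => ?_⟩, fun a ha => ?_⟩
  · rcases eq_or_ne j k with rfl | hjk
    · exact hce j
    · exact ⟨0, fun i hi => by simp [hoff hi hjk]⟩
  · obtain ⟨ha0, ha⟩ := (h.mem_iff _).1 (natCast_mem_weightRelations.2 ha)
    choose p hp using ha
    choose k hk using fun j => hprim j a (p j) (hp j)
    refine ⟨k, funext fun i => ?_⟩
    by_cases hi : i ∈ I 0
    · simpa [hzero hi] using ha0 i hi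
    · obtain ⟨j, hj⟩ := exists_mem_succ_of_notMem_zero h.partition hi
      rw [Finset.sum_apply, Finset.sum_eq_single j _ (by simp), hk j i hj, Pi.smul_apply,
        smul_eq_mul]
      exact fun m _ hmj => by simp [hoff hj hmj]

end Integrality

section Characters

variable {K : Type*} [Field K] {r : ℕ}

theorem character_eq_prod (m : Fin r → ℤ) (t : Fin r → Kˣ) :
    character m t = ∏ j, (t j : K) ^ m j := by
  simp [character]

theorem character_zero (t : Fin r → Kˣ) : (character 0 t : K) = 1 := by
  simp [character_eq_prod]

theorem character_one (m : Fin r → ℤ) : (character m (1 : Fin r → Kˣ) : K) = 1 := by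
  simp [character_eq_prod]

theorem character_mul (m : Fin r → ℤ) (t u : Fin r → Kˣ) :
    (character m (t * u) : K) = character m t * character m u := by
  simp [character_eq_prod, mul_zpow, Finset.prod_mul_distrib]

theorem character_add (m m' : Fin r → ℤ) (t : Fin r → Kˣ) :
    (character (m + m') t : K) = character m t * character m' t := by
  simp [character_eq_prod, zpow_add₀, Finset.prod_mul_distrib]

theorem character_zsmul (a : ℤ) (m : Fin r → ℤ) (t : Fin r → Kˣ) :
    (character (a • m) t : K) = character m t ^ a := by
  simp [character_eq_prod, mul_comm a, zpow_mul, Finset.prod_zpow]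

theorem character_sum_zsmul {ι : Type*} (S : Finset ι) (a : ι → ℤ) (s : ι → Fin r → ℤ)
    (t : Fin r → Kˣ) :
    (character (∑ i ∈ S, a i • s i) t : K) = ∏ i ∈ S, character (s i) t ^ a i := by
  classical
  induction S using Finset.induction_on with
  | empty => simp [character_zero]
  | insert i S hi IH =>
    rw [Finset.sum_insert hi, Finset.prod_insert hi, character_add, character_zsmul, IH]

theorem finite_setOf_zpow_eq {k : ℤ} (hk : k ≠ 0) (v : Kˣ) : {u : Kˣ | u ^ k = v}.Finite := by
  classical
  wlog hpos : 0 < k generalizing k v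
  · simpa [inv_inj] using this (neg_ne_zero.2 hk) v⁻¹ (by omega)
  lift k to ℕ using hpos.le
  refine ((Polynomial.nthRoots k (v : K)).toFinset.finite_toSet.preimage
    Units.val_injective.injOn).subset fun u hu => ?_
  simpa [Polynomial.mem_nthRoots (Int.natCast_pos.1 hpos)] using congrArg Units.val hu

theorem infinite_units [Infinite K] : Infinite Kˣ :=
  unitsEquivNeZero.infinite_iff.2 (Set.finite_singleton (0 : K)).infinite_compl.to_subtype

section LaurentEval

variable {W : Type*} [AddCommGroup W] [Module K W]

/-- The value at `t` of the Laurent polynomial `∑ m, t^m • g m` with coefficients in the vector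
space `W`. -/
noncomputable def laurentEval (W : Type*) [AddCommGroup W] [Module K W] (t : Fin r → Kˣ) :
    ((Fin r → ℤ) →₀ W) →ₗ[K] W :=
  Finsupp.lsum K fun m => (character m t : K) • LinearMap.id

theorem laurentEval_apply (t : Fin r → Kˣ) (g : (Fin r → ℤ) →₀ W) :
    laurentEval W t g = g.sum fun m w => (character m t : K) • w :=
  rfl

theorem laurentEval_single (t : Fin r → Kˣ) (m : Fin r → ℤ) (w : W) :
    laurentEval W t (Finsupp.single m w) = (character m t : K) • w := by
  simp [laurentEval_apply]

theorem laurentEval_mapRange {W' : Type*} [AddCommGroup W'] [Module K W'] (φ : W →ₗ[K] W')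
    (t : Fin r → Kˣ) (g : (Fin r → ℤ) →₀ W) :
    laurentEval W' t (Finsupp.mapRange.linearMap φ g) = φ (laurentEval W t g) := by
  induction g using Finsupp.induction_linear with
  | zero => simp
  | add g g' hg hg' => simp only [map_add, hg, hg']
  | single m w => simp [laurentEval_single]

variable [Infinite K]

theorem character_injective :
    Injective (character : (Fin r → ℤ) → (Fin r → Kˣ) → K) := by
  intro m m' h
  ext j
  by_contra hj
  have := infinite_units (K := K)
  refine (Set.infinite_univ (α := Kˣ)) ((finite_setOf_zpow_eq (sub_ne_zero.2 hj) 1).subset ?_)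
  intro u _
  have hu : ∀ m : Fin r → ℤ, character m (Pi.mulSingle j u) = ((u ^ m j : Kˣ) : K) := fun m => by
    rw [character, Finset.prod_eq_single j (fun k _ hk => by simp [hk]) (by simp),
      Pi.mulSingle_eq_same]
  have huj : u ^ m j = u ^ m' j := Units.ext (by rw [← hu, ← hu, h])
  simp [zpow_sub, huj]

theorem eq_of_laurentEval_eq {g g' : (Fin r → ℤ) →₀ W}
    (h : ∀ t : Fin r → Kˣ, laurentEval W t g = laurentEval W t g') : g = g' := by
  rw [← sub_eq_zero]
  ext m
  refine (Module.forall_dual_apply_eq_zero_iff K _).1 fun φ => ?_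
  let χ : (Fin r → ℤ) → (Fin r → Kˣ) →* K := fun m =>
    { toFun := character m, map_one' := character_one m, map_mul' := character_mul m }
  have hχ : Injective χ := fun m m' h => character_injective (congrArg DFunLike.coe h)
  have hind := (linearIndependent_monoidHom (Fin r → Kˣ) K).comp χ hχ
  refine DFunLike.congr_fun
    (linearIndependent_iff.1 hind (Finsupp.mapRange.linearMap φ (g - g')) (funext fun t => ?_)) m
  have ht : laurentEval K t (Finsupp.mapRange.linearMap φ (g - g')) = 0 := by
    rw [laurentEval_mapRange, map_sub, h, sub_self, map_zero]
  rw [Pi.zero_apply, ← ht, Finsupp.linearCombination_apply, laurentEval_apply, Finsupp.sum,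
    Finsupp.sum, Finset.sum_apply]
  exact Finset.sum_congr rfl fun m _ => mul_comm _ _

theorem sum_filter_eq_of_sum_character_smul_eq {ι : Type*} {S : Finset ι} {wt : ι → Fin r → ℤ}
    {g : ι → W} {w : W} (h : ∀ t : Fin r → Kˣ, ∑ d ∈ S, (character (wt d) t : K) • g d = w) :
    ∑ d ∈ S with wt d = 0, g d = w := by
  have heq : ∑ d ∈ S, Finsupp.single (wt d) (g d) = Finsupp.single 0 w :=
    eq_of_laurentEval_eq (K := K) fun t => by
      simp only [map_sum, laurentEval_single, h, character_zero, one_smul]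
  simpa [Finsupp.finsetSum_apply, Finsupp.single_apply, Finset.sum_filter]
    using DFunLike.congr_fun heq 0

end LaurentEval

end Characters

section WeightVectors

variable {K : Type*} [Field K] [Infinite K] {r : ℕ} {V : Type*} [AddCommGroup V] [Module K V]
  {ρ : Representation K (Fin r → Kˣ) V}

theorem differential_apply_of_weight (hρ : IsAlgebraic ρ) {m : Fin r → ℤ} {v : V}
    (hv : ∀ t, ρ t v = (character m t : K) • v) (ξ : Fin r → K) :
    differential ρ hρ ξ v = characterDiff K m ξ • v := by
  have heq : Finsupp.mapRange.linearMap (LinearMap.applyₗ v) hρ.choose = Finsupp.single m v :=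
    eq_of_laurentEval_eq (K := K) fun t => by
      rw [laurentEval_mapRange, laurentEval_single, ← hv t, hρ.choose_spec t]
      rfl
  have hsum : differential ρ hρ ξ v =
      (Finsupp.mapRange.linearMap (LinearMap.applyₗ v) hρ.choose).sum
        fun m w => characterDiff K m ξ • w := by
    rw [Finsupp.mapRange.linearMap_apply, Finsupp.sum_mapRange_index fun _ => smul_zero _]
    simp [differential, Finsupp.sum]
  rw [hsum, heq]
  exact Finsupp.sum_single_index (smul_zero _)

theorem span_weightVectors (hρ : IsAlgebraic ρ) :
    Submodule.span K {v : V | ∃ m : Fin r → ℤ, ∀ t, ρ t v = (character m t : K) • v} = ⊤ := by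
  obtain ⟨P, hP⟩ := hρ
  have hρP : ∀ t v, ρ t v = ∑ m ∈ P.support, (character m t : K) • P m v := fun t v => by
    simp [hP, Finsupp.sum]
  refine eq_top_iff.2 fun v _ => ?_
  have hv : v = ∑ m ∈ P.support, P m v := by
    simpa [hP, character_one, Finsupp.sum] using congrArg (· v) (map_one ρ).symm
  rw [hv]
  refine Submodule.sum_mem _ fun m hm => Submodule.subset_span ⟨m, fun t => ?_⟩
  have heq : ∑ m ∈ P.support, Finsupp.single m (ρ t (P m v)) =
      ∑ m ∈ P.support, Finsupp.single m ((character m t : K) • P m v) :=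
    eq_of_laurentEval_eq (K := K) fun u => by
      have hmul : ρ (u * t) v = ρ t (ρ u v) := by rw [mul_comm, map_mul]; rfl
      simpa only [hρP u, hρP (u * t), map_sum, map_smul, laurentEval_single, smul_smul,
        character_mul] using hmul.symm
  simpa [Finsupp.finsetSum_apply, Finsupp.single_apply, Finsupp.mem_support_iff.1 hm]
    using DFunLike.congr_fun heq m

theorem exists_isWeightBasis [FiniteDimensional K V] (hρ : IsAlgebraic ρ) :
    ∃ (b : Module.Basis (Fin (Module.finrank K V)) K V)
      (s : Fin (Module.finrank K V) → Fin r → ℤ), IsWeightBasis ρ b s := by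
  let b := Module.Basis.ofSpan (span_weightVectors hρ).ge
  have hb : ∀ i, ∃ m : Fin r → ℤ, ∀ t, ρ t (b i) = (character m t : K) • b i := fun i =>
    Module.Basis.ofSpan_subset (span_weightVectors hρ).ge ⟨i, rfl⟩
  have := Module.Finite.finite_basis b
  let ε := Finite.equivFinOfCardEq (Module.finrank_eq_nat_card_basis b).symm
  choose m hm using hb
  exact ⟨b.reindex ε, fun i => m (ε.symm i), fun t i => by rw [Module.Basis.reindex_apply, hm]⟩

end WeightVectors

section Diagonal

theorem repr_apply_of_diagonal {R M ι : Type*} [CommSemiring R] [AddCommMonoid M] [Module R M]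
    (b : Module.Basis ι R M) {A : Module.End R M} {c : ι → R} (hA : ∀ i, A (b i) = c i • b i)
    (v : M) (i : ι) : b.repr (A v) i = c i * b.repr v i := by
  classical
  have heq : b.coord i ∘ₗ A = c i • b.coord i := b.ext fun k => by
    by_cases hk : k = i <;> simp [hA, hk]
  exact LinearMap.congr_fun heq v

variable {K : Type*} [Field K] {r n : ℕ} {V : Type*} [AddCommGroup V] [Module K V]
  {ρ : Representation K (Fin r → Kˣ) V} {b : Module.Basis (Fin n) K V} {s : Fin n → Fin r → ℤ}

theorem IsWeightBasis.repr_apply (hb : IsWeightBasis ρ b s) (t : Fin r → Kˣ) (v : V) (i : Fin n) :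
    b.repr (ρ t v) i = character (s i) t * b.repr v i :=
  repr_apply_of_diagonal b (hb t) v i

theorem IsWeightBasis.repr_differential_apply [Infinite K] (hb : IsWeightBasis ρ b s)
    (hρ : IsAlgebraic ρ) (ξ : Fin r → K) (v : V) (i : Fin n) :
    b.repr (differential ρ hρ ξ v) i = characterDiff K (s i) ξ * b.repr v i :=
  repr_apply_of_diagonal b (c := fun i => characterDiff K (s i) ξ)
    (fun i => differential_apply_of_weight hρ (fun t => hb t i) ξ) v i

end Diagonal

section Monomials

variable {K : Type*} [Field K] {V : Type*} [AddCommGroup V] [Module K V]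

/-- The monomial function `∏ i, x_i ^ d_i` on `V`, the `x_i` being the coordinates in the basis
`b`. -/
noncomputable def coordMonomial {ι : Type*} [Fintype ι] (b : Module.Basis ι K V) (d : ι → ℕ) :
    V → K :=
  ∏ i, (b.coord i : V → K) ^ d i

section Basis

variable {ι : Type*} [Fintype ι] (b : Module.Basis ι K V)

theorem coordMonomial_apply (d : ι → ℕ) (v : V) :
    coordMonomial b d v = ∏ i, b.repr v i ^ d i := by
  simp [coordMonomial]

theorem coordMonomial_apply_eq_zero {d : ι → ℕ} {v : V} (h : ¬support d ⊆ support (b.repr v)) :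
    coordMonomial b d v = 0 := by
  obtain ⟨i, hdi, hvi⟩ := Set.not_subset.1 h
  rw [coordMonomial_apply]
  exact Finset.prod_eq_zero (Finset.mem_univ i) (by rw [notMem_support.1 hvi, zero_pow hdi])

theorem coordMonomial_sum_smul {κ : Type*} [Fintype κ] (k : κ → ℕ) (c : κ → ι → ℕ) :
    coordMonomial b (∑ j, k j • c j) = ∏ j, coordMonomial b (c j) ^ k j := by
  ext v
  simp only [coordMonomial_apply, Finset.sum_apply, Pi.smul_apply, Finset.prod_apply, Pi.pow_apply,
    ← Finset.prod_pow_eq_pow_sum, ← Finset.prod_pow, ← pow_mul, smul_eq_mul]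
  rw [Finset.prod_comm]
  simp only [mul_comm]

theorem polyFun_eq_adjoin_coord {ι : Type*} [Finite ι] (b : Module.Basis ι K V) :
    polyFun K V = Algebra.adjoin K (Set.range fun i => (b.coord i : V → K)) := by
  have := Fintype.ofFinite ι
  refine le_antisymm (Algebra.adjoin_le ?_) (Algebra.adjoin_mono ?_)
  · rintro _ ⟨φ, rfl⟩
    have hφ : (φ : V → K) = ∑ i, φ (b i) • (b.coord i : V → K) := by
      ext v
      conv_lhs => rw [← b.sum_repr v, map_sum]
      simp [mul_comm]
    change (φ : V → K) ∈ _
    rw [hφ]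
    exact sum_mem fun i _ => Subalgebra.smul_mem _ (Algebra.subset_adjoin (Set.mem_range_self i)) _
  · rintro _ ⟨i, rfl⟩
    exact ⟨b.coord i, rfl⟩

theorem mem_polyFun_iff {f : V → K} :
    f ∈ polyFun K V ↔ ∃ c : (ι → ℕ) →₀ K, (c.sum fun d a => a • coordMonomial b d) = f := by
  have hclosure : (Submonoid.closure (Set.range fun i => (b.coord i : V → K)) : Set (V → K)) =
      Set.range (coordMonomial b) := by
    ext g
    simp [Submonoid.mem_closure_range_iff_of_fintype, coordMonomial, eq_comm]
  rw [polyFun_eq_adjoin_coord b, ← Subalgebra.mem_toSubmodule, Algebra.adjoin_eq_span, hclosure,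
    Finsupp.mem_span_range_iff_exists_finsupp]

theorem coordMonomial_mem_polyFun (d : ι → ℕ) : coordMonomial b d ∈ polyFun K V :=
  (mem_polyFun_iff b).2 ⟨Finsupp.single d 1, by simp⟩

end Basis

variable {r n : ℕ} {ρ : Representation K (Fin r → Kˣ) V} {b : Module.Basis (Fin n) K V}
  {s : Fin n → Fin r → ℤ}

theorem IsWeightBasis.coordMonomial_rep_apply (hb : IsWeightBasis ρ b s) (d : Fin n → ℕ)
    (t : Fin r → Kˣ) (v : V) :
    coordMonomial b d (ρ t v) = character (∑ i, d i • s i) t * coordMonomial b d v := by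
  have hchar := character_sum_zsmul Finset.univ (fun i => (d i : ℤ)) s t
  simp only [natCast_zsmul, zpow_natCast] at hchar
  simp only [coordMonomial_apply, hb.repr_apply, mul_pow, Finset.prod_mul_distrib, hchar]

theorem IsWeightBasis.coordMonomial_mem_invariants (hb : IsWeightBasis ρ b s) {d : Fin n → ℕ}
    (hd : ∑ i, d i • s i = 0) : coordMonomial b d ∈ invariants ρ :=
  ⟨coordMonomial_mem_polyFun b d, fun t v => by
    rw [hb.coordMonomial_rep_apply, hd, character_zero, one_mul]⟩

theorem IsWeightBasis.sum_weight_zero_eq [Infinite K] (hb : IsWeightBasis ρ b s)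
    {c : (Fin n → ℕ) →₀ K} {f : V → K} (hf : (c.sum fun d a => a • coordMonomial b d) = f)
    {v : V} {y : K} (hv : ∀ t, f (ρ t v) = y) :
    ∑ d ∈ c.support with ∑ i, d i • s i = 0, c d * coordMonomial b d v = y :=
  sum_filter_eq_of_sum_character_smul_eq (K := K) fun t => by
    rw [← hv t, ← hf, Finsupp.sum, Finset.sum_apply]
    refine Finset.sum_congr rfl fun d _ => ?_
    rw [Pi.smul_apply, hb.coordMonomial_rep_apply, smul_eq_mul, smul_eq_mul, mul_left_comm]

theorem IsWeightBasis.mem_span_coordMonomial_of_mem_invariants [Infinite K]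
    (hb : IsWeightBasis ρ b s) {f : V → K} (hf : f ∈ invariants ρ) :
    f ∈ Submodule.span K (coordMonomial b '' {d | ∑ i, d i • s i = 0}) := by
  obtain ⟨c, hc⟩ := (mem_polyFun_iff b).1 hf.1
  have hfc : f = ∑ d ∈ c.support with ∑ i, d i • s i = 0, c d • coordMonomial b d := by
    ext v
    simpa using (hb.sum_weight_zero_eq hc fun t => hf.2 t v).symm
  rw [hfc]
  exact sum_mem fun d hd => Submodule.smul_mem _ _ <|
    Submodule.subset_span ⟨d, (Finset.mem_filter.1 hd).2, rfl⟩

end Monomials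

section Visibility

variable {K : Type*} [Field K] {r n : ℕ} {V : Type*} [AddCommGroup V] [Module K V]
  {ρ : Representation K (Fin r → Kˣ) V} {b : Module.Basis (Fin n) K V} {s : Fin n → Fin r → ℤ}

theorem IsWeightBasis.isNilpotentVec [Infinite K] (hb : IsWeightBasis ρ b s) {x : V}
    (hx : ∀ a : Fin n → ℕ, ∑ i, a i • s i = 0 → support a ⊆ support (b.repr x) → a = 0) :
    IsNilpotentVec ρ x := by
  intro f hf hvanish
  obtain ⟨c, hc⟩ := (mem_polyFun_iff b).1 hf
  rw [← hb.sum_weight_zero_eq hc (v := x) fun t => hvanish _ ⟨t, rfl⟩, ← hc, Finsupp.sum,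
    Finset.sum_apply, Finset.sum_filter]
  refine Finset.sum_congr rfl fun d _ => ?_
  rcases eq_or_ne d 0 with rfl | hd
  · simp [coordMonomial_apply]
  · have hzero : coordMonomial b d 0 = 0 := coordMonomial_apply_eq_zero b (by simpa using hd)
    rw [Pi.smul_apply, hzero, smul_zero]
    split_ifs with hsum
    · rw [coordMonomial_apply_eq_zero b fun hsupp => hd (hx d hsum hsupp), mul_zero]
    · rfl

theorem IsWeightBasis.prod_repr_zpow_eq_of_orbit_eq (hb : IsWeightBasis ρ b s) {a : Fin n → ℤ}
    (ha : ∑ i, a i • s i = 0) {x y : V} (hxy : orbit ρ x = orbit ρ y) :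
    ∏ i, b.repr x i ^ a i = ∏ i, b.repr y i ^ a i := by
  obtain ⟨t, rfl⟩ : x ∈ orbit ρ y := hxy ▸ ⟨1, by simp⟩
  simp only [hb.repr_apply, mul_zpow, Finset.prod_mul_distrib, ← character_sum_zsmul, ha,
    character_zero, one_mul]

theorem exists_int_relation_of_mem_weightRelations {d : Fin n → ℚ} (hd : d ∈ weightRelations s) :
    ∃ a : Fin n → ℤ, ∑ i, a i • s i = 0 ∧ ∀ i, a i = 0 ↔ d i = 0 := by
  obtain ⟨N, hN⟩ := IsLocalization.exist_integer_multiples_of_finite (nonZeroDivisors ℤ) d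
  choose a ha using hN
  have haN : ∀ i, (a i : ℚ) = (N : ℤ) * d i := fun i => by simpa using ha i
  have hN0 : ((N : ℤ) : ℚ) ≠ 0 := Int.cast_ne_zero.2 (nonZeroDivisors.coe_ne_zero N)
  refine ⟨a, ?_, fun i => ?_⟩
  · ext k
    have hk := congrArg (((N : ℤ) : ℚ) * ·) (congrFun (mem_weightRelations.1 hd) k)
    simp only [Finset.sum_apply, Pi.smul_apply, ratWeight, smul_eq_mul, Finset.mul_sum,
      ← mul_assoc, ← haN, Pi.zero_apply, mul_zero] at hk
    simpa using mod_cast hk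
  · rw [← Int.cast_eq_zero (α := ℚ), haN, mul_eq_zero, or_iff_right hN0]

/-- Otherwise all the vectors with the support of a given relation would be nilpotent, and the
relation provides a nonconstant function on the set of their orbits. -/
theorem IsVisible.hasNonnegSupports_weightRelations [Infinite K] (hvis : IsVisible ρ)
    (hb : IsWeightBasis ρ b s) : HasNonnegSupports (weightRelations s) := by
  classical
  intro d hd hd0
  by_contra! hcon
  obtain ⟨a, ha, had⟩ := exists_int_relation_of_mem_weightRelations hd
  obtain ⟨i₀, hi₀ : d i₀ ≠ 0⟩ := ne_iff.1 hd0
  obtain ⟨x, hx⟩ : ∃ x : Kˣ → V, ∀ u i,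
      b.repr (x u) i = if d i = 0 then 0 else if i = i₀ then (u : K) else 1 :=
    ⟨fun u => b.equivFun.symm fun i => if d i = 0 then 0 else if i = i₀ then (u : K) else 1,
      fun u i => congrFun (b.equivFun.apply_symm_apply _) i⟩
  have hnil : ∀ u, IsNilpotentVec ρ (x u) := fun u => hb.isNilpotentVec fun c hc hsupp => by
    by_contra hc0
    refine hcon _ (natCast_mem_weightRelations.2 hc) (fun h => hc0 ?_) (fun i => by simp) ?_
    · exact funext fun i => Nat.cast_eq_zero.1 (congrFun h i)
    · intro i hi hdi
      exact hsupp (a := i) (by simpa using hi) (by rw [hx, if_pos hdi])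
  have hprod : ∀ u, ∏ i, b.repr (x u) i ^ a i = ((u ^ a i₀ : Kˣ) : K) := fun u => by
    rw [Finset.prod_eq_single i₀ (fun i _ hi => ?_) (by simp), hx, if_neg hi₀, if_pos rfl,
      Units.val_zpow_eq_zpow_val]
    by_cases hdi : d i = 0 <;> simp [hx, hdi, hi, (had i).2]
  have := infinite_units (K := K)
  refine Set.infinite_univ (α := Kˣ) (Set.Finite.of_finite_fibers (fun u => orbit ρ (x u))
    (hvis.subset ?_) ?_)
  · rintro _ ⟨u, -, rfl⟩
    exact ⟨x u, hnil u, rfl⟩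
  · rintro _ ⟨v, -, rfl⟩
    refine (finite_setOf_zpow_eq (mt (had i₀).1 hi₀) (v ^ a i₀)).subset fun u hu => Units.ext ?_
    rw [← hprod u, ← hprod v]
    exact hb.prod_repr_zpow_eq_of_orbit_eq ha hu.2

theorem IsVisible.exists_isCircuitPartition [Infinite K] (hvis : IsVisible ρ)
    (hb : IsWeightBasis ρ b s) :
    ∃ (l : ℕ) (I : Fin (l + 1) → Finset (Fin n)) (e : Fin n → ℚ),
      IsCircuitPartition (weightRelations s) I e :=
  (hvis.hasNonnegSupports_weightRelations hb).exists_isCircuitPartition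

end Visibility

section Cartan

variable {K : Type*} [Field K] {r n l : ℕ} {V : Type*} [AddCommGroup V] [Module K V]
  {ρ : Representation K (Fin r → Kˣ) V} {b : Module.Basis (Fin n) K V} {s : Fin n → Fin r → ℤ}
  {I : Fin (l + 1) → Finset (Fin n)} {e : Fin n → ℚ}

theorem repr_blockMap_of_mem_zero (hI : ∀ i, ∃! j, i ∈ I j) (w : Fin l → K) {i : Fin n}
    (hi : i ∈ I 0) : b.repr (blockMap b I w) i = 0 := by
  classical
  have hne : ∀ j : Fin l, i ∉ I j.succ := fun j hj => j.succ_ne_zero ((hI i).unique hj hi)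
  simp [blockMap, Fintype.linearCombination_apply, Finsupp.single_apply, hne]

theorem repr_blockMap_of_mem_succ (hI : ∀ i, ∃! j, i ∈ I j) (w : Fin l → K) {i : Fin n}
    {j : Fin l} (hi : i ∈ I j.succ) : b.repr (blockMap b I w) i = w j := by
  classical
  have hiff : ∀ k : Fin l, i ∈ I k.succ ↔ k = j := fun k =>
    ⟨fun hk => Fin.succ_injective l ((hI i).unique hk hi), fun hk => hk ▸ hi⟩
  simp [blockMap, Fintype.linearCombination_apply, Finsupp.single_apply, hiff]

theorem blockMap_injective (hI : ∀ i, ∃! j, i ∈ I j) (hne : ∀ j : Fin l, (I j.succ).Nonempty) :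
    Injective (blockMap b I) := by
  intro w w' hw
  ext j
  obtain ⟨i, hi⟩ := hne j
  rw [← repr_blockMap_of_mem_succ (b := b) hI w hi, hw, repr_blockMap_of_mem_succ hI w' hi]

theorem mem_range_blockMap_iff (hI : ∀ i, ∃! j, i ∈ I j) {x : V} :
    x ∈ LinearMap.range (blockMap b I) ↔ (∀ i ∈ I 0, b.repr x i = 0) ∧
      ∀ j : Fin l, ∃ c, ∀ i ∈ I j.succ, b.repr x i = c := by
  refine ⟨?_, fun ⟨hzero, hsucc⟩ => ?_⟩
  · rintro ⟨w, rfl⟩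
    exact ⟨fun i hi => repr_blockMap_of_mem_zero hI w hi, fun j =>
      ⟨w j, fun i hi => repr_blockMap_of_mem_succ hI w hi⟩⟩
  · choose w hw using hsucc
    refine ⟨w, b.repr.injective (Finsupp.ext fun i => ?_)⟩
    by_cases hi : i ∈ I 0
    · rw [repr_blockMap_of_mem_zero hI w hi, hzero i hi]
    · obtain ⟨j, hj⟩ := exists_mem_succ_of_notMem_zero hI hi
      rw [repr_blockMap_of_mem_succ hI w hj, hw j i hj]

theorem characterDiff_apply (m : Fin r → ℤ) (ξ : Fin r → K) :
    characterDiff K m ξ = ∑ k, (m k : K) * ξ k := by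
  simp [characterDiff]

namespace IsCircuitPartition

theorem finrank_range_blockMap {R : Submodule ℚ (Fin n → ℚ)} (h : IsCircuitPartition R I e) :
    Module.finrank K (LinearMap.range (blockMap b I)) = l := by
  rw [LinearMap.finrank_range_of_inj (blockMap_injective h.partition h.nonempty),
    Module.finrank_fin_fun]

variable [CharZero K]

theorem sum_mul_characterDiff (h : IsCircuitPartition (weightRelations s) I e) (j : Fin l)
    (ξ : Fin r → K) : ∑ i ∈ I j.succ, (e i : K) * characterDiff K (s i) ξ = 0 := by
  have hcoord : ∀ k, ∑ i ∈ I j.succ, (e i : K) * (s i k : K) = 0 := fun k => by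
    have hk := congrFun (h.sum_smul_eq_zero j) k
    simp only [Finset.sum_apply, Pi.smul_apply, ratWeight, smul_eq_mul, Pi.zero_apply] at hk
    exact_mod_cast congrArg (Rat.cast : ℚ → K) hk
  simp_rw [characterDiff_apply, Finset.mul_sum]
  rw [Finset.sum_comm]
  simp_rw [← mul_assoc, ← Finset.sum_mul, hcoord, zero_mul, Finset.sum_const_zero]

theorem apply_of_sum_smul_characterDiff_eq_zero
    (h : IsCircuitPartition (weightRelations s) I e) {a : Fin n → K}
    (ha : ∑ i, a i • characterDiff K (s i) = 0) :
    (∀ i ∈ I 0, a i = 0) ∧ ∀ j : Fin l, ∃ c : K, ∀ i ∈ I j.succ, a i = e i * c := by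
  have hdual : ∀ φ : Module.Dual ℚ K, (fun i => φ (a i)) ∈ weightRelations s := fun φ => by
    refine mem_weightRelations.2 (funext fun k => ?_)
    have hφ : ∀ i, φ (a i * (s i k : K)) = φ (a i) * (s i k : ℚ) := fun i => by
      rw [mul_comm, ← zsmul_eq_mul, map_zsmul, zsmul_eq_mul, mul_comm]
    have hk := congrArg φ (LinearMap.congr_fun ha (Pi.single k 1))
    simpa [characterDiff_apply, Pi.single_apply, ratWeight, hφ] using hk
  simpa only [Rat.smul_def] using h.apply_of_forall_dual hdual

theorem mem_range_pi_characterDiff_iff (h : IsCircuitPartition (weightRelations s) I e)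
    {y : Fin n → K} :
    y ∈ LinearMap.range (LinearMap.pi fun i => characterDiff K (s i)) ↔
      ∀ j : Fin l, ∑ i ∈ I j.succ, (e i : K) * y i = 0 := by
  refine ⟨?_, fun hy => ?_⟩
  · rintro ⟨ξ, rfl⟩ j
    exact h.sum_mul_characterDiff j ξ
  by_contra hmem
  obtain ⟨f, hfy, hf⟩ := Submodule.exists_le_ker_of_notMem hmem
  obtain ⟨a, rfl⟩ := (dotProductEquiv K (Fin n)).surjective f
  have ha : ∑ i, a i • characterDiff K (s i) = 0 := LinearMap.ext fun ξ => by
    simpa [dotProduct] using hf ⟨ξ, rfl⟩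
  obtain ⟨hzero, hsucc⟩ := h.apply_of_sum_smul_characterDiff_eq_zero ha
  refine hfy ?_
  rw [dotProductEquiv_apply_apply, dotProduct, sum_eq_sum_sum_of_existsUnique h.partition,
    Fin.sum_univ_succ, Finset.sum_eq_zero fun i hi => by rw [hzero i hi, zero_mul], zero_add]
  refine Finset.sum_eq_zero fun j _ => ?_
  obtain ⟨c, hc⟩ := hsucc j
  rw [← mul_zero c, ← hy j, Finset.mul_sum]
  exact Finset.sum_congr rfl fun i hi => by rw [hc i hi]; ring

theorem mem_lieOrbit_blockMap_one_iff (h : IsCircuitPartition (weightRelations s) I e)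
    (hb : IsWeightBasis ρ b s) (hρ : IsAlgebraic ρ) {y : V} :
    y ∈ lieOrbit ρ hρ (blockMap b I fun _ => 1) ↔ (∀ i ∈ I 0, b.repr y i = 0) ∧
      ∀ j : Fin l, ∑ i ∈ I j.succ, (e i : K) * b.repr y i = 0 := by
  have hzero : ∀ ξ, ∀ i ∈ I 0,
      b.repr (differential ρ hρ ξ (blockMap b I fun _ => 1)) i = 0 := fun ξ i hi => by
    rw [hb.repr_differential_apply, repr_blockMap_of_mem_zero h.partition _ hi, mul_zero]
  have hsucc : ∀ ξ, ∀ j : Fin l, ∀ i ∈ I j.succ,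
      b.repr (differential ρ hρ ξ (blockMap b I fun _ => 1)) i = characterDiff K (s i) ξ :=
    fun ξ j i hi => by
      rw [hb.repr_differential_apply, repr_blockMap_of_mem_succ h.partition _ hi, mul_one]
  refine ⟨?_, fun ⟨hy0, hy⟩ => ?_⟩
  · rintro ⟨ξ, rfl⟩
    refine ⟨hzero ξ, fun j => ?_⟩
    rw [← h.sum_mul_characterDiff j ξ]
    exact Finset.sum_congr rfl fun i hi => congrArg _ (hsucc ξ j i hi)
  · obtain ⟨ξ, hξ⟩ := h.mem_range_pi_characterDiff_iff.2 hy
    refine ⟨ξ, b.repr.injective (Finsupp.ext fun i => ?_)⟩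
    by_cases hi : i ∈ I 0
    · exact (hzero ξ i hi).trans (hy0 i hi).symm
    · obtain ⟨j, hj⟩ := exists_mem_succ_of_notMem_zero h.partition hi
      exact (hsucc ξ j i hj).trans (congrFun hξ i)

theorem range_blockMap_eq_cartanCandidate (h : IsCircuitPartition (weightRelations s) I e)
    (hb : IsWeightBasis ρ b s) (hρ : IsAlgebraic ρ) :
    LinearMap.range (blockMap b I) = cartanCandidate ρ hρ (blockMap b I fun _ => 1) := by
  classical
  ext x
  have hiff : x ∈ cartanCandidate ρ hρ (blockMap b I fun _ => 1) ↔ ∀ ξ,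
      (∀ i ∈ I 0, characterDiff K (s i) ξ * b.repr x i = 0) ∧
        ∀ j : Fin l, ∑ i ∈ I j.succ, (e i : K) * (characterDiff K (s i) ξ * b.repr x i) = 0 := by
    simp only [← hb.repr_differential_apply hρ, ← h.mem_lieOrbit_blockMap_one_iff hb hρ]
    exact Set.range_subset_iff
  rw [mem_range_blockMap_iff h.partition, hiff]
  refine ⟨fun ⟨hzero, hsucc⟩ ξ => ⟨fun i hi => by rw [hzero i hi, mul_zero], fun j => ?_⟩,
    fun hx => ?_⟩
  · obtain ⟨c, hc⟩ := hsucc j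
    rw [← zero_mul c, ← h.sum_mul_characterDiff j ξ, Finset.sum_mul]
    exact Finset.sum_congr rfl fun i hi => by rw [hc i hi, mul_assoc]
  have hrel : ∑ i, (if i ∈ I 0 then b.repr x i else e i * b.repr x i) •
      characterDiff K (s i) = 0 := LinearMap.ext fun ξ => by
    obtain ⟨hzero, hsucc⟩ := hx ξ
    simp only [LinearMap.sum_apply, LinearMap.smul_apply, LinearMap.zero_apply, smul_eq_mul]
    rw [sum_eq_sum_sum_of_existsUnique h.partition, Fin.sum_univ_succ,
      Finset.sum_eq_zero fun i hi => by rw [if_pos hi, mul_comm, hzero i hi], zero_add]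
    refine Finset.sum_eq_zero fun j _ => (Finset.sum_congr rfl fun i hi => ?_).trans (hsucc j)
    rw [if_neg fun hi0 => j.succ_ne_zero ((h.partition i).unique hi hi0)]
    ring
  obtain ⟨hzero, hsucc⟩ := h.apply_of_sum_smul_characterDiff_eq_zero hrel
  refine ⟨fun i hi => by simpa [hi] using hzero i hi, fun j => ?_⟩
  obtain ⟨c, hc⟩ := hsucc j
  refine ⟨c, fun i hi => ?_⟩
  have hei : (e i : K) ≠ 0 := Rat.cast_ne_zero.2 (h.pos j i hi).ne'
  have hi0 : i ∉ I 0 := fun hi0 => j.succ_ne_zero ((h.partition i).unique hi hi0)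
  exact mul_left_cancel₀ hei (by simpa only [if_neg hi0] using hc i hi)

end IsCircuitPartition

end Cartan

section Quotient

variable {K : Type*} [Field K] [Infinite K] {r n l : ℕ} {V : Type*} [AddCommGroup V] [Module K V]
  {ρ : Representation K (Fin r → Kˣ) V} {b : Module.Basis (Fin n) K V} {s : Fin n → Fin r → ℤ}
  {I : Fin (l + 1) → Finset (Fin n)} {e : Fin n → ℚ}

/-- On the vectors `x(w)`, the monomial of the `j`-th block is a power of `w j`. -/
theorem algebraicIndependent_coordMonomial (hI : ∀ i, ∃! j, i ∈ I j)
    (hne : ∀ j : Fin l, (I j.succ).Nonempty) {c : Fin l → Fin n → ℕ}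
    (hc : ∀ j i, c j i ≠ 0 ↔ i ∈ I j.succ) :
    AlgebraicIndependent K fun j => coordMonomial b (c j) := by
  have hpow : ∀ w j, coordMonomial b (c j) (blockMap b I w) = w j ^ ∑ i, c j i := fun w j => by
    rw [coordMonomial_apply, ← Finset.prod_pow_eq_pow_sum]
    refine Finset.prod_congr rfl fun i _ => ?_
    by_cases hi : i ∈ I j.succ
    · rw [repr_blockMap_of_mem_succ hI w hi]
    · rw [not_not.1 (mt (hc j i).1 hi), pow_zero, pow_zero]
  have hdeg : ∀ j, ∑ i, c j i ≠ 0 := fun j hj => by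
    obtain ⟨i, hi⟩ := hne j
    exact (hc j i).2 hi (Finset.sum_eq_zero_iff.1 hj i (Finset.mem_univ i))
  have hX : AlgebraicIndependent K fun j => (MvPolynomial.X j : MvPolynomial (Fin l) K) ^
      ∑ i, c j i := by
    simpa using MvPolynomial.algebraicIndependent_polynomial_aeval_X
      (fun j => (Polynomial.X : Polynomial K) ^ ∑ i, c j i)
      fun j => (Polynomial.transcendental_X K).pow (Nat.pos_of_ne_zero (hdeg j))
  have heval : ∀ (p : MvPolynomial (Fin l) K) (w : Fin l → K),
      MvPolynomial.aeval (fun j => coordMonomial b (c j)) p (blockMap b I w) =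
        MvPolynomial.eval w (MvPolynomial.aeval (fun j => MvPolynomial.X j ^ ∑ i, c j i) p) :=
    fun p w => by
      rw [← MvPolynomial.coe_aeval_eq_eval, RingHom.coe_coe, MvPolynomial.comp_aeval_apply]
      refine (MvPolynomial.comp_aeval_apply _
        (Pi.evalAlgHom K (fun _ : V => K) (blockMap b I w)) p).trans ?_
      simp [hpow]
  intro p q hpq
  refine hX (MvPolynomial.funext fun w => ?_)
  rw [← heval, ← heval]
  exact congrFun hpq _

theorem invariants_eq_adjoin (hb : IsWeightBasis ρ b s) {κ : Type*} [Fintype κ]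
    {c : κ → Fin n → ℕ} (hc : ∀ j, ∑ i, c j i • s i = 0)
    (hgen : ∀ a : Fin n → ℕ, ∑ i, a i • s i = 0 → ∃ k : κ → ℕ, a = ∑ j, k j • c j) :
    invariants ρ = Algebra.adjoin K (Set.range fun j => coordMonomial b (c j)) := by
  refine le_antisymm (fun f hf => ?_) (Algebra.adjoin_le ?_)
  · rw [← Subalgebra.mem_toSubmodule]
    refine Submodule.span_le.2 ?_ (hb.mem_span_coordMonomial_of_mem_invariants hf)
    rintro _ ⟨a, ha, rfl⟩
    obtain ⟨k, rfl⟩ := hgen a ha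
    rw [coordMonomial_sum_smul, SetLike.mem_coe, Subalgebra.mem_toSubmodule]
    exact prod_mem fun j _ => pow_mem (Algebra.subset_adjoin (Set.mem_range_self j)) _
  · rintro _ ⟨j, rfl⟩
    exact hb.coordMonomial_mem_invariants (hc j)

theorem IsCircuitPartition.quotientDim_eq (h : IsCircuitPartition (weightRelations s) I e)
    (hb : IsWeightBasis ρ b s) : quotientDim ρ = (l : WithBot ℕ∞) := by
  obtain ⟨c, hsupp, hc, hgen⟩ := h.exists_primitiveCircuits
  have hind := algebraicIndependent_coordMonomial (K := K) (b := b) h.partition h.nonempty hsupp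
  rw [quotientDim, invariants_eq_adjoin hb hc hgen,
    ← ringKrullDim_eq_of_ringEquiv hind.aevalEquiv.toRingEquiv,
    MvPolynomial.ringKrullDim_of_isNoetherianRing, ringKrullDim_eq_zero_of_field, zero_add,
    Nat.card_fin]

end Quotient

theorem IsCircuitPartition.isCartanSubspace_range_blockMap {K : Type*} [Field K] [CharZero K]
    {r n l : ℕ} {V : Type*} [AddCommGroup V] [Module K V]
    {ρ : Representation K (Fin r → Kˣ) V} {b : Module.Basis (Fin n) K V}
    {s : Fin n → Fin r → ℤ} {I : Fin (l + 1) → Finset (Fin n)} {e : Fin n → ℚ}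
    (h : IsCircuitPartition (weightRelations s) I e) (hb : IsWeightBasis ρ b s)
    (hρ : IsAlgebraic ρ) : IsCartanSubspace ρ hρ (LinearMap.range (blockMap b I)) := by
  have : Infinite K := CharZero.infinite K
  have hc := h.range_blockMap_eq_cartanCandidate hb hρ
  exact ⟨_, hc, by rw [← hc, h.finrank_range_blockMap, h.quotientDim_eq hb]⟩

end TorusRep

theorem mainTheorem9_general {K : Type*} [Field K] [CharZero K]
    {V : Type*} [AddCommGroup V] [Module K V] [FiniteDimensional K V] {r : ℕ}
    (ρ : Representation K (Fin r → Kˣ) V) (hρ : TorusRep.IsAlgebraic ρ)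
    (hvis : TorusRep.IsVisible ρ) :
    TorusRep.IsPolar ρ hρ ∧
    (∃ (b : Module.Basis (Fin (Module.finrank K V)) K V)
      (s : Fin (Module.finrank K V) → Fin r → ℤ), TorusRep.IsWeightBasis ρ b s) ∧
    ∀ (n : ℕ) (b : Module.Basis (Fin n) K V) (s : Fin n → Fin r → ℤ),
      TorusRep.IsWeightBasis ρ b s →
      (∃ (l : ℕ) (I : Fin (l + 1) → Finset (Fin n)), TorusRep.IsBlockPartition s l I) ∧
      ∀ (l : ℕ) (I : Fin (l + 1) → Finset (Fin n)), TorusRep.IsBlockPartition s l I →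
        LinearMap.range (TorusRep.blockMap b I) =
          TorusRep.cartanCandidate ρ hρ (TorusRep.blockMap b I fun _ => 1) ∧
        TorusRep.IsCartanSubspace ρ hρ (LinearMap.range (TorusRep.blockMap b I)) ∧
        Module.finrank K (LinearMap.range (TorusRep.blockMap b I)) = l ∧
        TorusRep.quotientDim ρ = (l : WithBot ℕ∞) := by
  have : Infinite K := CharZero.infinite K
  obtain ⟨b, s, hb⟩ := TorusRep.exists_isWeightBasis hρ
  refine ⟨?_, ⟨b, s, hb⟩, fun n b s hb => ⟨?_, fun l I hI => ?_⟩⟩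
  · obtain ⟨l, I, e, h⟩ := hvis.exists_isCircuitPartition hb
    obtain ⟨v, -, hv⟩ := h.isCartanSubspace_range_blockMap hb hρ
    exact ⟨v, hv⟩
  · obtain ⟨l, I, e, h⟩ := hvis.exists_isCircuitPartition hb
    exact ⟨l, I, h.isBlockPartition⟩
  · obtain ⟨e, h⟩ := hI.exists_isCircuitPartition
    exact ⟨h.range_blockMap_eq_cartanCandidate hb hρ, h.isCartanSubspace_range_blockMap hb hρ,
      h.finrank_range_blockMap, h.quotientDim_eq hb⟩

theorem mainTheorem9 {K : Type*} [Field K] [IsAlgClosed K] [CharZero K]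
    {V : Type*} [AddCommGroup V] [Module K V] [FiniteDimensional K V] {r : ℕ}
    (ρ : Representation K (Fin r → Kˣ) V) (hρ : TorusRep.IsAlgebraic ρ)
    (hvis : TorusRep.IsVisible ρ) :
    TorusRep.IsPolar ρ hρ ∧
    (∃ (b : Module.Basis (Fin (Module.finrank K V)) K V)
      (s : Fin (Module.finrank K V) → Fin r → ℤ), TorusRep.IsWeightBasis ρ b s) ∧
    ∀ (n : ℕ) (b : Module.Basis (Fin n) K V) (s : Fin n → Fin r → ℤ),
      TorusRep.IsWeightBasis ρ b s →
      (∃ (l : ℕ) (I : Fin (l + 1) → Finset (Fin n)), TorusRep.IsBlockPartition s l I) ∧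
      ∀ (l : ℕ) (I : Fin (l + 1) → Finset (Fin n)), TorusRep.IsBlockPartition s l I →
        LinearMap.range (TorusRep.blockMap b I) =
          TorusRep.cartanCandidate ρ hρ (TorusRep.blockMap b I fun _ => 1) ∧
        TorusRep.IsCartanSubspace ρ hρ (LinearMap.range (TorusRep.blockMap b I)) ∧
        Module.finrank K (LinearMap.range (TorusRep.blockMap b I)) = l ∧
        TorusRep.quotientDim ρ = (l : WithBot ℕ∞) :=
  mainTheorem9_general ρ hρ hvis
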